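/- Write $A-A=\{a-a' : a,a'\in A\}$ for $A\subseteq\mathbb Z$, and let $\bar d(A)=\limsup_{n\to\infty}\frac{|A\cap\{1,\dots,n\}|}{n}$ be its upper density. A set $S\subseteq\mathbb Z$ is a *set of density recurrence* if $(A-A)\cap S\neq\varnothing$ for every $A\subseteq\mathbb Z$ with $\bar d(A)>0$. It is a *set of Bohr recurrence* if for all $d\in\mathbb N$, all $\boldsymbol\alpha\in\mathbb T^d=(\mathbb R/\mathbb Z)^d$ and all $\varepsilon>0$ there is an $n\in S$ such that $\|n\boldsymbol\alpha\|<\varepsilon$, where $\|(x_1,\dots,x_d)\|=\max_j\|x_j\|$ and $\|x_j\|$ is the distance from $x_j$ to the nearest integer. **Corollary.** If $E\subseteq\mathbb Z$ is infinite, then there is a set $S\subseteq E-E$ such that $S$ is a set of Bohr recurrence but not a set of density recurrence. -/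

import Mathlib

open Filter
open scoped Pointwise

/-- The upper asymptotic density `limsup_{n → ∞} |A ∩ {1, …, n}| / n` of a set of integers.
The sequence takes values in `[0, 1]`, so the real-valued `limsup` is the usual one. -/
noncomputable def upperDensity (A : Set ℤ) : ℝ :=
  limsup (fun n : ℕ => ((A ∩ Set.Icc 1 (n : ℤ)).ncard : ℝ) / (n : ℝ)) atTop

/-- `S` is a set of density recurrence: `(A - A) ∩ S ≠ ∅` for every set `A` of integers of
positive upper density. -/
def IsDensityRecurrent (S : Set ℤ) : Prop :=
  ∀ A : Set ℤ, 0 < upperDensity A → ((A - A) ∩ S).Nonempty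

/-- `S` is a set of Bohr recurrence: for all `d`, all `α ∈ 𝕋ᵈ` and all `ε > 0` there is `n ∈ S`
with `‖n α‖ < ε`. The torus is `Fin d → UnitAddCircle`, where `UnitAddCircle` is `ℝ / ℤ` normed by
the distance to the nearest integer, and the product carries the maximum norm. -/
def IsBohrRecurrent (S : Set ℤ) : Prop :=
  ∀ (d : ℕ) (α : Fin d → UnitAddCircle) (ε : ℝ), 0 < ε → ∃ n ∈ S, ‖n • α‖ < ε

/-! The set `S` is made recurrent for all finite colorings of ℤ; Bohr recurrence follows by coloring
`n` with a net point of the torus near `n • α`.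

Finite step, for `c` colors. Let `v` range over the `k`-subsets of an `n`-set, `n = 2k + 2c`. As `E`
is unbounded, there are `e v ∈ E` and reals `θ t` with `e v * θ t` close, mod 2, to 1 if `t ∈ v` and
to 0 otherwise. Take all `e v - e w` with `v`, `w` disjoint: a coloring of ℤ colors the Kneser
graph, which has a monochromatic edge. Yet such a difference changes the parity of `⌊x θ t + s⌋` in
exactly `2k` coordinates (away from integers), so the `x` with fewer than `k` odd coordinates avoid
it, and so do those with fewer than `k` even ones. These two classes miss only the `2c + 1` middle
layers of the cube, a negligible part for large `n`.

Combination. A single avoiding set could lose half its density at each stage, so the pair is kept.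
If `D₀, D₁` avoid `S` and `B₀, B₁` avoid `S'`, then for a long enough period `T` both `(D₀ + T B₀) ∪
(D₁ + T B₁)` and `(D₀ + T B₁) ∪ (D₁ + T B₀)` avoid `S ∪ T S'`, and total sizes multiply. The pair
thus keeps filling more than half of its interval, and one of the two limit sets has upper density
at least 1/4. -/

/-! ### Parity of flags of signed sets (a combinatorial Borsuk–Ulam argument) -/

/-- The sum of `F` over the facets of the signed set `(A, B)`, that is, over the signed sets
obtained by deleting one element. -/
def facetSum (F : Finset ℕ → Finset ℕ → ZMod 2) (A B : Finset ℕ) : ZMod 2 :=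
  ∑ a ∈ A, F (A.erase a) B + ∑ b ∈ B, F A (B.erase b)

theorem sum_erase_erase_eq_zero (G : Finset ℕ → ZMod 2) (A : Finset ℕ) :
    ∑ a ∈ A, ∑ b ∈ A.erase a, G ((A.erase a).erase b) = 0 := by
  rw [Finset.sum_sigma']
  refine Finset.sum_involution (fun p _ => ⟨p.2, p.1⟩) ?_ ?_ ?_ ?_
  · rintro ⟨a, b⟩ _
    simp only [Finset.erase_right_comm (a := b) (b := a)]
    exact CharTwo.add_self_eq_zero _
  · rintro ⟨a, b⟩ h _ heq
    simp only [Finset.mem_sigma, Finset.mem_erase] at h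
    simp only [Sigma.mk.injEq] at heq
    exact h.2.1 heq.1
  · rintro ⟨a, b⟩ h
    simp only [Finset.mem_sigma, Finset.mem_erase] at h ⊢
    exact ⟨h.2.2, Ne.symm h.2.1, h.1⟩
  · rintro ⟨a, b⟩ _
    rfl

/-- Two deletions can be made in either order, so every term occurs twice: the boundary of a
boundary vanishes mod 2. -/
theorem facetSum_facetSum (F : Finset ℕ → Finset ℕ → ZMod 2) (A B : Finset ℕ) :
    facetSum (facetSum F) A B = 0 := by
  simp only [facetSum, Finset.sum_add_distrib]
  rw [sum_erase_erase_eq_zero (fun X => F X B), sum_erase_erase_eq_zero (fun X => F A X),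
    Finset.sum_comm (s := B) (t := A), zero_add, add_zero]
  exact CharTwo.add_self_eq_zero _

/-- The number modulo 2 of flags of signed sets of sizes `1, …, k` that end in `(A, B)`, each flag
weighted by the product of the values of `h`. -/
def flagCount (h : ℕ → Finset ℕ → Finset ℕ → ZMod 2) : ℕ → Finset ℕ → Finset ℕ → ZMod 2
  | 0 => fun _ _ => 1
  | k + 1 => fun A B => h (k + 1) A B * facetSum (flagCount h k) A B

/-- Swapping the two sides changes `flagCount` by a value of `facetSum`, and `facetSum` kills such
values. -/
theorem facetSum_flagCount_comm {h : ℕ → Finset ℕ → Finset ℕ → ZMod 2}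
    (hh : ∀ k A B, A ≠ B → h k B A = 1 + h k A B) (k : ℕ) (A B : Finset ℕ)
    (hd : Disjoint A B) (hc : A.card + B.card = k + 1) :
    facetSum (flagCount h k) B A = facetSum (flagCount h k) A B := by
  induction k generalizing A B with
  | zero => simp [facetSum, flagCount, add_comm]
  | succ k ih =>
    have key : ∀ X Y : Finset ℕ, Disjoint X Y → X.card + Y.card = k + 1 →
        flagCount h (k + 1) Y X = facetSum (flagCount h k) X Y + flagCount h (k + 1) X Y := by
      intro X Y hXY hXYc
      have hne : X ≠ Y := by
        rintro rfl
        rw [disjoint_self] at hXY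
        subst hXY
        simp at hXYc
      simp only [flagCount, ih X Y hXY hXYc, hh (k + 1) X Y hne]
      ring
    have h1 : facetSum (flagCount h (k + 1)) B A =
        facetSum (facetSum (flagCount h k)) A B + facetSum (flagCount h (k + 1)) A B := by
      rw [facetSum, facetSum, facetSum, add_comm, add_add_add_comm, ← Finset.sum_add_distrib,
        ← Finset.sum_add_distrib]
      congr 1
      · refine Finset.sum_congr rfl fun a ha => key _ _ ?_ ?_
        · exact hd.mono_left (Finset.erase_subset _ _)
        · have := Finset.card_erase_add_one ha
          omega
      · refine Finset.sum_congr rfl fun b hb => key _ _ ?_ ?_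
        · exact hd.mono_right (Finset.erase_subset _ _)
        · have := Finset.card_erase_add_one hb
          omega
    rw [h1, facetSum_facetSum, zero_add]

theorem sum_powerset_erase_eq_zero (G : Finset ℕ → ZMod 2) {R : Finset ℕ} {a : ℕ} (ha : a ∈ R) :
    ∑ A ∈ R.powerset, G (A.erase a) = 0 := by
  obtain ⟨T, hT, rfl⟩ : ∃ T, a ∉ T ∧ insert a T = R :=
    ⟨R.erase a, Finset.notMem_erase a R, Finset.insert_erase ha⟩
  rw [Finset.sum_powerset_insert hT, ← Finset.sum_add_distrib]
  refine Finset.sum_eq_zero fun A hA => ?_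
  have : a ∉ A := fun h => hT (Finset.mem_powerset.1 hA h)
  rw [Finset.erase_insert this, Finset.erase_eq_of_notMem this]
  exact CharTwo.add_self_eq_zero _

/-- For antipodal weights, the weighted number of full flags is odd. -/
theorem sum_flagCount {h : ℕ → Finset ℕ → Finset ℕ → ZMod 2}
    (hh : ∀ k A B, A ≠ B → h k B A = 1 + h k A B) (n : ℕ) :
    ∑ A ∈ (Finset.range n).powerset, flagCount h n A (Finset.range n \ A) = 1 := by
  induction n with
  | zero => simp [flagCount]
  | succ n ih =>
    set R := Finset.range n with hR
    have hn : n ∉ R := by simp [hR]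
    have hcompl : ∀ A ∈ R.powerset, insert n R \ A = insert n (R \ A) := by
      intro A hA
      rw [Finset.mem_powerset] at hA
      exact Finset.insert_sdiff_of_notMem _ fun h => hn (hA h)
    have hsd : ∀ A : Finset ℕ, insert n R \ insert n A = R \ A := by
      intro A
      ext x
      simp only [Finset.mem_sdiff, Finset.mem_insert]
      grind
    have hflip : ∑ A ∈ R.powerset, flagCount h (n + 1) A (insert n R \ A)
        = ∑ A ∈ R.powerset, flagCount h (n + 1) (R \ A) (insert n A) := by
      refine Finset.sum_nbij' (fun A => R \ A) (fun A => R \ A) ?_ ?_ ?_ ?_ ?_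
      · intro A _
        simp
      · intro A _
        simp
      · intro A hA
        exact Finset.sdiff_sdiff_eq_self (Finset.mem_powerset.1 hA)
      · intro A hA
        exact Finset.sdiff_sdiff_eq_self (Finset.mem_powerset.1 hA)
      · intro A hA
        rw [hcompl A hA, Finset.sdiff_sdiff_eq_self (Finset.mem_powerset.1 hA)]
    -- The weights of two antipodes add up to 1, so the pair contributes the whole facet sum.
    -- Deleting `n` gives the count for `range n`; the other facets cancel below.
    have hpair : ∀ A ∈ R.powerset,
        flagCount h (n + 1) (R \ A) (insert n A) + flagCount h (n + 1) (insert n A) (R \ A)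
          = flagCount h n A (R \ A)
            + ∑ a ∈ R, flagCount h n (insert n (A.erase a)) (R \ insert a A) := by
      intro A hA
      rw [Finset.mem_powerset] at hA
      have hnA : n ∉ A := fun h => hn (hA h)
      have hne : insert n A ≠ R \ A := by
        intro he
        have : n ∈ R \ A := he ▸ Finset.mem_insert_self n A
        exact hn (Finset.mem_sdiff.1 this).1
      have hd : Disjoint (insert n A) (R \ A) := by
        rw [← hsd A]
        exact Finset.disjoint_sdiff
      have hcard : (insert n A).card + (R \ A).card = n + 1 := by
        rw [Finset.card_insert_of_notMem hnA, Finset.card_sdiff_of_subset hA]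
        have := Finset.card_le_card hA
        simp only [hR, Finset.card_range] at this ⊢
        omega
      have h1 : flagCount h (n + 1) (R \ A) (insert n A)
          + flagCount h (n + 1) (insert n A) (R \ A)
          = facetSum (flagCount h n) (insert n A) (R \ A) := by
        simp only [flagCount, facetSum_flagCount_comm hh n _ _ hd hcard, hh (n + 1) _ _ hne]
        linear_combination
          (h (n + 1) (insert n A) (R \ A) * facetSum (flagCount h n) (insert n A) (R \ A))
            * (CharTwo.two_eq_zero : (2 : ZMod 2) = 0)
      rw [h1, facetSum, Finset.sum_insert hnA, Finset.erase_insert hnA, add_assoc]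
      congr 1
      conv_rhs => rw [← Finset.union_sdiff_of_subset hA,
        Finset.sum_union Finset.disjoint_sdiff]
      congr 1
      · refine Finset.sum_congr rfl fun a ha => ?_
        rw [Finset.erase_insert_of_ne (by rintro rfl; exact hnA ha), Finset.insert_eq_of_mem ha,
          Finset.union_sdiff_of_subset hA]
      · refine Finset.sum_congr rfl fun a ha => ?_
        rw [Finset.erase_eq_of_notMem (Finset.mem_sdiff.1 ha).2, Finset.union_sdiff_of_subset hA,
          Finset.sdiff_insert]
    rw [Finset.range_add_one, ← hR, Finset.sum_powerset_insert hn, hflip]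
    simp only [hsd]
    rw [← Finset.sum_add_distrib, Finset.sum_congr rfl hpair, Finset.sum_add_distrib, ih,
      Finset.sum_comm]
    rw [Finset.sum_eq_zero, add_zero]
    -- Once `a` is deleted, the side it was on is forgotten, so each term occurs twice.
    intro a ha
    rw [← sum_powerset_erase_eq_zero
      (fun X => flagCount h n (insert n X) (R \ insert a X)) ha]
    refine Finset.sum_congr rfl fun A _ => ?_
    congr 2
    ext x
    simp only [Finset.mem_insert, Finset.mem_erase]
    grind

/-! ### Kneser's theorem -/

/-- A monotone two-sided ranking of the disjoint pairs of subsets of `range n` which is never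
balanced on pairs of total size at least `p` takes at least `n - p + 1` values. -/
theorem le_of_rank_ne (r : Finset ℕ → ℕ) (hr : Antitone r) {n p c : ℕ} (hp : 0 < p) (hpn : p ≤ n)
    (hne : ∀ A B : Finset ℕ, A ⊆ Finset.range n → B ⊆ Finset.range n → Disjoint A B →
      p ≤ A.card + B.card → r A ≠ r B ∧ min (r A) (r B) < c) :
    n - p + 1 ≤ c := by
  classical
  -- The encoding only breaks ties, which can occur below size `p`, so that `h` is antipodal
  -- everywhere.
  let g : Finset ℕ → Finset ℕ → Prop := fun A B =>
    r A < r B ∨ (r A = r B ∧ Encodable.encode A < Encodable.encode B)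
  let h : ℕ → Finset ℕ → Finset ℕ → ZMod 2 := fun k A B => (k : ZMod 2) + if g A B then 1 else 0
  have hh : ∀ k A B, A ≠ B → h k B A = 1 + h k A B := by
    intro k A B hAB
    have hiff : g B A ↔ ¬ g A B := by
      have : Encodable.encode A ≠ Encodable.encode B := fun h => hAB (Encodable.encode_injective h)
      simp only [g]
      omega
    by_cases hg : g A B
    · have h2 : ¬ g B A := by rw [hiff]; exact not_not.2 hg
      simp only [h, hg, h2, if_true, if_false]
      linear_combination -(CharTwo.two_eq_zero : (2 : ZMod 2) = 0)
    · have h2 : g B A := hiff.2 hg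
      simp only [h, hg, h2, if_true, if_false]
      ring
  have key : ∀ k A B, A ⊆ Finset.range n → B ⊆ Finset.range n → Disjoint A B →
      A.card + B.card = k → p ≤ k → flagCount h k A B ≠ 0 →
      h k A B ≠ 0 ∧ min (r A) (r B) + (k - p) < c := by
    intro k
    induction k with
    | zero => intros; omega
    | succ k ih =>
      intro A B hA hB hd hk hpk hf
      have hf' : h (k + 1) A B ≠ 0 ∧ facetSum (flagCount h k) A B ≠ 0 := by
        simpa only [flagCount, mul_ne_zero_iff] using hf
      refine ⟨hf'.1, ?_⟩
      have h0 := hne A B hA hB hd (by omega)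
      rcases hpk.eq_or_lt with hpk | hpk
      · have := h0.2
        omega
      obtain ⟨A', B', hA', hB', hk', hf''⟩ : ∃ A' B', A' ⊆ A ∧ B' ⊆ B ∧
          A'.card + B'.card = k ∧ flagCount h k A' B' ≠ 0 := by
        by_contra! hcon
        apply hf'.2
        rw [facetSum, Finset.sum_eq_zero, Finset.sum_eq_zero, add_zero]
        · intro b hb
          refine hcon _ _ subset_rfl (Finset.erase_subset _ _) ?_
          have := Finset.card_erase_add_one hb
          omega
        · intro a ha
          refine hcon _ _ (Finset.erase_subset _ _) subset_rfl ?_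
          have := Finset.card_erase_add_one ha
          omega
      have hd' : Disjoint A' B' := hd.mono hA' hB'
      obtain ⟨hh', hlt⟩ := ih A' B' (hA'.trans hA) (hB'.trans hB) hd' hk' (by omega) hf''
      have h0' := hne A' B' (hA'.trans hA) (hB'.trans hB) hd' (by omega)
      -- The summand `k` in `h` makes the side of smaller rank alternate along a flag of nonzero
      -- weight. As ranks cannot grow with the sets, each alternation strictly lowers the minimum.
      have hgg : g A B ↔ ¬ g A' B' := by
        have e1 : ∀ z : ZMod 2, z + 1 ≠ 0 → z + 1 + 1 ≠ 0 → False := by decide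
        have e0 : ∀ z : ZMod 2, z + 0 ≠ 0 → z + 1 + 0 ≠ 0 → False := by decide
        have a1 := hf'.1
        simp only [h, Nat.cast_add, Nat.cast_one] at a1 hh'
        by_cases g1 : g A B <;> by_cases g2 : g A' B' <;>
          simp only [g1, g2, if_true, if_false] at a1 hh' ⊢
        · exact (e1 _ hh' a1).elim
        · simp
        · simp
        · exact (e0 _ hh' a1).elim
      have ra := hr hA'
      have rb := hr hB'
      simp only [g] at hgg
      omega
  obtain ⟨A, hA, hf⟩ := Finset.exists_ne_zero_of_sum_ne_zero
    (by rw [sum_flagCount hh n]; exact one_ne_zero :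
      ∑ A ∈ (Finset.range n).powerset, flagCount h n A (Finset.range n \ A) ≠ 0)
  rw [Finset.mem_powerset] at hA
  have hcard : A.card + (Finset.range n \ A).card = n := by
    have := Finset.card_sdiff_add_card_eq_card hA
    rw [Finset.card_range] at this
    omega
  have := (key n A _ hA Finset.sdiff_subset Finset.disjoint_sdiff hcard hpn hf).2
  omega

/-- The Lovász–Kneser theorem. -/
theorem exists_disjoint_powersetCard_color_eq {n k c : ℕ} (hk : 0 < k) (hn : 2 * k + c ≤ n + 1)
    (hkn : 2 * k ≤ n + 1)
    (col : Finset ℕ → Fin c) :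
    ∃ v ∈ (Finset.range n).powersetCard k, ∃ w ∈ (Finset.range n).powersetCard k,
      Disjoint v w ∧ col v = col w := by
  classical
  by_contra! hcon
  -- Least color of a `k`-subset of `A`; the empty infimum is the extra top value `c`.
  let r' : Finset ℕ → Fin (c + 1) := fun A => (A.powersetCard k).inf fun v => (col v).castSucc
  have hr' : Antitone r' := fun A B hAB => Finset.inf_mono (Finset.powersetCard_mono hAB)
  have hval : ∀ A : Finset ℕ, k ≤ A.card → ∃ v ∈ A.powersetCard k, r' A = (col v).castSucc := by
    intro A hA
    exact Finset.exists_mem_eq_inf _ (Finset.powersetCard_nonempty.2 hA) _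
  have hsub : ∀ {A v : Finset ℕ}, A ⊆ Finset.range n → v ∈ A.powersetCard k →
      v ∈ (Finset.range n).powersetCard k := fun hA hv => Finset.powersetCard_mono hA hv
  -- Total size `2 * k - 1` is the least that forces one of the two sets to contain a `k`-subset.
  have := le_of_rank_ne (fun A => (r' A : ℕ)) (fun A B hAB => hr' hAB) (n := n) (p := 2 * k - 1)
    (c := c) (by omega) (by omega) ?_
  · omega
  intro A B hA hB hd hAB
  have hlt : ∀ X : Finset ℕ, k ≤ X.card → (r' X : ℕ) < c := by
    intro X hX
    obtain ⟨v, -, hv⟩ := hval X hX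
    simp [hv]
  have htop : ∀ X : Finset ℕ, X.card < k → (r' X : ℕ) = c := by
    intro X hX
    simp only [r', Finset.powersetCard_eq_empty.2 hX, Finset.inf_empty]
    rfl
  rcases lt_or_ge A.card k with h1 | h1
  · have h2 := hlt B (by omega)
    have h3 := htop A h1
    omega
  rcases lt_or_ge B.card k with h2 | h2
  · have h3 := hlt A h1
    have h4 := htop B h2
    omega
  obtain ⟨v, hv, hva⟩ := hval A h1
  obtain ⟨w, hw, hwb⟩ := hval B h2
  refine ⟨?_, by have := hlt A h1; omega⟩
  rw [hva, hwb]
  intro he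
  refine hcon v (hsub hA hv) w (hsub hB hw) ?_ ?_
  · exact hd.mono (Finset.mem_powersetCard.1 hv).1 (Finset.mem_powersetCard.1 hw).1
  · exact Fin.ext he

/-! ### Middle layers of the cube are negligible -/

/-- The induction rests on `(2m + 1)(2m + 3) ≤ 4(m + 1)²`. Squaring avoids the square root in the
decay of `m.centralBinom / 4 ^ m`. -/
theorem centralBinom_sq_mul_le (m : ℕ) : m.centralBinom ^ 2 * (2 * m + 1) ≤ 16 ^ m := by
  induction m with
  | zero => simp
  | succ m ih =>
    have h := Nat.succ_mul_centralBinom_succ m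
    have h2 : (m + 1) ^ 2 * ((m + 1).centralBinom ^ 2 * (2 * (m + 1) + 1))
        ≤ (m + 1) ^ 2 * 16 ^ (m + 1) := by
      calc (m + 1) ^ 2 * ((m + 1).centralBinom ^ 2 * (2 * (m + 1) + 1))
          = ((m + 1) * (m + 1).centralBinom) ^ 2 * (2 * (m + 1) + 1) := by ring
        _ = (m.centralBinom ^ 2 * (2 * m + 1)) * (4 * ((2 * m + 1) * (2 * m + 3))) := by
            rw [h]; ring
        _ ≤ 16 ^ m * (4 * (4 * (m + 1) ^ 2)) := by
            exact Nat.mul_le_mul ih (Nat.mul_le_mul_left 4 (by nlinarith))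
        _ = (m + 1) ^ 2 * 16 ^ (m + 1) := by ring
    exact Nat.le_of_mul_le_mul_left h2 (by positivity)

theorem exists_mul_centralBinom_le (c : ℕ) {δ : ℝ} (hδ : 0 < δ) :
    ∃ m, c < m ∧ (c : ℝ) * m.centralBinom ≤ δ * 4 ^ m := by
  obtain ⟨m, hm⟩ := exists_nat_gt (max (c : ℝ) ((c / δ) ^ 2))
  refine ⟨m, by exact_mod_cast (le_max_left _ _).trans_lt hm, ?_⟩
  have h1 : (c / δ) ^ 2 < m := (le_max_right _ _).trans_lt hm
  have h2 : (m.centralBinom : ℝ) ^ 2 * (2 * m + 1) ≤ 16 ^ m := by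
    exact_mod_cast centralBinom_sq_mul_le m
  have h3 : (c : ℝ) ^ 2 ≤ δ ^ 2 * (2 * m + 1) := by
    rw [div_pow, div_lt_iff₀ (by positivity)] at h1
    nlinarith [sq_nonneg δ, mul_nonneg (sq_nonneg δ) (Nat.cast_nonneg (α := ℝ) m)]
  refine abs_le_of_sq_le_sq' ?_ (by positivity) |>.2
  calc ((c : ℝ) * m.centralBinom) ^ 2 = (c : ℝ) ^ 2 * (m.centralBinom : ℝ) ^ 2 := by ring
    _ ≤ δ ^ 2 * (2 * m + 1) * (m.centralBinom : ℝ) ^ 2 := by gcongr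
    _ = δ ^ 2 * ((m.centralBinom : ℝ) ^ 2 * (2 * m + 1)) := by ring
    _ ≤ δ ^ 2 * 16 ^ m := by gcongr
    _ = (δ * 4 ^ m) ^ 2 := by
      rw [mul_pow, ← pow_mul, mul_comm m 2, pow_mul]
      norm_num

/-! ### Prescribing multiples mod 2 along an infinite set -/

theorem Set.Infinite.exists_lt_abs {E : Set ℤ} (hE : E.Infinite) (K : ℝ) :
    ∃ x ∈ E, K < |(x : ℝ)| := by
  by_contra! hcon
  refine hE ((Set.finite_Icc (-⌈K⌉) ⌈K⌉).subset fun x hx => ?_)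
  have h : |x| ≤ ⌈K⌉ := by
    have := (hcon x hx).trans (Int.le_ceil K)
    exact_mod_cast this
  exact abs_le.1 h

/-- An infinite set of integers contains families `e` such that the multiples `e v * θ` can be
prescribed modulo `2`, up to a small error. -/
theorem Set.Infinite.exists_approx_mod_two {α : Type*} [DecidableEq α] {E : Set ℤ}
    (hE : E.Infinite) {η : ℝ} (hη : 0 < η) (V : Finset α) :
    ∃ e : α → ℤ, (∀ v ∈ V, e v ∈ E) ∧ ∃ l : ℝ, 0 < l ∧ ∀ τ : α → ℝ, ∃ a : ℝ,
      ∀ θ ∈ Set.Icc a (a + l), ∀ v ∈ V, ∃ z : ℤ, |e v * θ - τ v - 2 * z| ≤ η := by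
  induction V using Finset.induction_on with
  | empty => exact ⟨fun _ => 0, by simp, 1, one_pos, fun _ => ⟨0, by simp⟩⟩
  | insert v₀ V hv₀ ih =>
    obtain ⟨e, heE, l, hl, he⟩ := ih
    -- Solutions of `x θ ≡ τ v₀` mod 2 are `2 / |x| ≤ l / 2` apart, so one lies in the first half of
    -- the old interval, leaving room `l / 2`. Neither `x` nor the new length depends on `τ`: one
    -- family `e` must serve all targets.
    obtain ⟨x, hxE, hx⟩ := hE.exists_lt_abs (4 / l)
    have hx0 : 0 < |(x : ℝ)| := lt_trans (by positivity) hx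
    have hper : 2 / |(x : ℝ)| ≤ l / 2 := by
      rw [div_lt_iff₀ hl] at hx
      rw [div_le_iff₀ hx0]
      linarith
    have hne : ∀ v ∈ V, v ≠ v₀ := fun v hv h => hv₀ (h ▸ hv)
    refine ⟨Function.update e v₀ x, ?_, min (l / 2) (η / |(x : ℝ)|), by positivity, fun τ => ?_⟩
    · intro v hv
      rcases Finset.mem_insert.1 hv with rfl | hv
      · simpa using hxE
      · rw [Function.update_of_ne (hne v hv)]
        exact heE v hv
    obtain ⟨a, ha⟩ := he τ
    obtain ⟨k, hk, -⟩ := existsUnique_add_zsmul_mem_Ico (by positivity : 0 < 2 / |(x : ℝ)|)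
      (τ v₀ / x) a
    refine ⟨τ v₀ / x + k • (2 / |(x : ℝ)|), fun θ hθ v hv => ?_⟩
    rcases Finset.mem_insert.1 hv with rfl | hv
    · rw [Function.update_self]
      have hxne : (x : ℝ) ≠ 0 := abs_pos.1 hx0
      have hz : ∃ z : ℤ, (x : ℝ) * (τ v / x + k • (2 / |(x : ℝ)|)) = τ v + 2 * z := by
        rcases abs_choice (x : ℝ) with h | h
        · refine ⟨k, ?_⟩
          rw [h, zsmul_eq_mul]
          field_simp
        · refine ⟨-k, ?_⟩
          rw [h, zsmul_eq_mul]
          push_cast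
          field_simp
      obtain ⟨z, hz⟩ := hz
      refine ⟨z, ?_⟩
      have h1 : (x : ℝ) * θ - τ v - 2 * z = x * (θ - (τ v / x + k • (2 / |(x : ℝ)|))) := by
        rw [mul_sub, hz]; ring
      rw [h1, abs_mul, abs_of_nonneg (sub_nonneg.2 hθ.1)]
      have h2 : θ - (τ v / x + k • (2 / |(x : ℝ)|)) ≤ η / |(x : ℝ)| := by
        linarith [hθ.2, min_le_right (l / 2) (η / |(x : ℝ)|)]
      rw [le_div_iff₀ hx0] at h2
      linarith
    · rw [Function.update_of_ne (hne v hv)]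
      refine ha θ ⟨hk.1.trans hθ.1, ?_⟩ v hv
      linarith [hθ.2, min_le_left (l / 2) (η / |(x : ℝ)|), hk.2]

/-! ### The finite step: recurrent differences avoided by an almost covering pair -/

/-- `S` is recurrent for colorings of `ℤ` with `c` colors. -/
def IsChromaticRecurrent (c : ℕ) (S : Set ℤ) : Prop :=
  ∀ f : ℤ → Fin c, ∃ x y, f x = f y ∧ x - y ∈ S

/-- No difference of two elements of `B` lies in `S`. -/
def AvoidsDifferences (B : Finset ℕ) (S : Set ℤ) : Prop :=
  ∀ x ∈ B, ∀ y ∈ B, (x : ℤ) - y ∉ S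

theorem Int.floor_eq_add_of_abs_sub_lt {z z' ρ : ℝ} {h : ℤ} (h0 : ρ ≤ Int.fract z)
    (h1 : Int.fract z ≤ 1 - ρ) (hz : |z' - z - h| < ρ) : ⌊z'⌋ = ⌊z⌋ + h := by
  rw [Int.floor_eq_iff]
  have := abs_lt.1 hz
  have e := Int.floor_add_fract z
  push_cast
  constructor <;> linarith

/-- The shifts are spaced by `1 / Q ≥ 2ρ` on the circle, while the bad points form an open arc of
length `2ρ`. -/
theorem card_filter_fract_le_one (z : ℝ) {Q : ℕ} (hQ : 0 < Q) {ρ : ℝ} (hρ : 2 * ρ * Q ≤ 1) :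
    ((Finset.range Q).filter fun i : ℕ =>
      ¬ (ρ ≤ Int.fract (z + i / Q) ∧ Int.fract (z + i / Q) ≤ 1 - ρ)).card ≤ 1 := by
  have hQ' : (0 : ℝ) < Q := by exact_mod_cast hQ
  have key : ∀ i j : ℕ, i < j → j < Q →
      ¬ (ρ ≤ Int.fract (z + i / Q) ∧ Int.fract (z + i / Q) ≤ 1 - ρ) →
      ¬ (ρ ≤ Int.fract (z + j / Q) ∧ Int.fract (z + j / Q) ≤ 1 - ρ) → False := by
    intro i j hij hj hi' hj'
    have near : ∀ w : ℝ, ¬ (ρ ≤ Int.fract w ∧ Int.fract w ≤ 1 - ρ) → ∃ m : ℤ, |w - m| < ρ := by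
      intro w hw
      have e := Int.floor_add_fract w
      have e0 := Int.fract_nonneg w
      have e1 := Int.fract_lt_one w
      by_cases h : ρ ≤ Int.fract w
      · refine ⟨⌊w⌋ + 1, ?_⟩
        have : 1 - ρ < Int.fract w := by
          by_contra! h2
          exact hw ⟨h, h2⟩
        rw [abs_lt]
        push_cast
        constructor <;> linarith
      · refine ⟨⌊w⌋, ?_⟩
        rw [abs_lt]
        constructor <;> linarith
    obtain ⟨a, ha⟩ := near _ hi'
    obtain ⟨b, hb⟩ := near _ hj'
    have hd : |((j : ℝ) - i) / Q - ((b - a : ℤ) : ℝ)| < 2 * ρ := by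
      have : ((j : ℝ) - i) / Q - ((b - a : ℤ) : ℝ) = (z + j / Q - b) - (z + i / Q - a) := by
        push_cast; ring
      rw [this]
      exact (abs_sub _ _).trans_lt (by linarith)
    have hd2 : |((j : ℝ) - i) - ((b - a : ℤ) : ℝ) * Q| < 1 := by
      have e : ((j : ℝ) - i) - ((b - a : ℤ) : ℝ) * Q
          = (((j : ℝ) - i) / Q - ((b - a : ℤ) : ℝ)) * Q := by field_simp
      rw [e, abs_mul, abs_of_pos hQ']
      calc _ < 2 * ρ * Q := by gcongr
        _ ≤ 1 := hρ
    have hd3 : |((j : ℤ) - i) - (b - a) * Q| < 1 := by exact_mod_cast hd2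
    have hd4 : ((j : ℤ) - i) = (b - a) * Q := by
      have := abs_lt.1 hd3
      omega
    have p1 : 0 < b - a := by
      by_contra! h
      have : (b - a) * (Q : ℤ) ≤ 0 := mul_nonpos_of_nonpos_of_nonneg h (by positivity)
      omega
    have : (Q : ℤ) ≤ (b - a) * Q := le_mul_of_one_le_left (by positivity) p1
    omega
  rw [Finset.card_le_one]
  intro i hi j hj
  simp only [Finset.mem_filter, Finset.mem_range] at hi hj
  rcases lt_trichotomy i j with h | h | h
  · exact (key i j h hj.1 hi.2 hj.2).elim
  · exact h
  · exact (key j i h hi.1 hj.2 hi.2).elim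

/-- The number of subsets of a `2 m`-element set with size within `c` of `m`. -/
theorem card_filter_middle_le {m c k : ℕ} (hk : k + c = m) (R : Finset ℕ) (hR : R.card = 2 * m) :
    (R.powerset.filter fun U => ¬ (U.card < k ∨ (R \ U).card < k)).card
      ≤ (2 * c + 1) * m.centralBinom := by
  have hsub : (R.powerset.filter fun U => ¬ (U.card < k ∨ (R \ U).card < k))
      ⊆ (Finset.Icc k (k + 2 * c)).biUnion fun j => R.powersetCard j := by
    intro U hU
    simp only [Finset.mem_filter, Finset.mem_powerset, not_or, not_lt] at hU
    simp only [Finset.mem_biUnion, Finset.mem_Icc, Finset.mem_powersetCard]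
    have := Finset.card_sdiff_add_card_eq_card hU.1
    exact ⟨U.card, by omega, hU.1, rfl⟩
  refine (Finset.card_le_card hsub).trans (Finset.card_biUnion_le.trans ?_)
  refine (Finset.sum_le_card_nsmul _ _ m.centralBinom fun j _ => ?_).trans ?_
  · rw [Finset.card_powersetCard, hR]
    exact Nat.choose_le_centralBinom j m
  · rw [Nat.card_Icc, smul_eq_mul]
    gcongr
    omega

theorem AvoidsDifferences.shift {B : Finset ℕ} {S : Set ℤ} (h : AvoidsDifferences B S) {a : ℕ}
    (ha : ∀ x ∈ B, a ≤ x) : AvoidsDifferences (B.image fun x => x - a) S := by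
  intro x' hx' y' hy'
  obtain ⟨x, hx, rfl⟩ := Finset.mem_image.1 hx'
  obtain ⟨y, hy, rfl⟩ := Finset.mem_image.1 hy'
  have := h x hx y hy
  rwa [Nat.cast_sub (ha x hx), Nat.cast_sub (ha y hy), sub_sub_sub_cancel_right]

/-- A nonempty pair of disjoint sets avoiding `S` can be translated so that `0` lies in the
first one. -/
theorem AvoidsDifferences.exists_zero_mem {B₀ B₁ : Finset ℕ} {S : Set ℤ} {N : ℕ}
    (h₀ : AvoidsDifferences B₀ S) (h₁ : AvoidsDifferences B₁ S) (hd : Disjoint B₀ B₁)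
    (hB₀ : B₀ ⊆ Finset.range N) (hB₁ : B₁ ⊆ Finset.range N) (hne : (B₀ ∪ B₁).Nonempty) :
    ∃ C₀ C₁ : Finset ℕ, AvoidsDifferences C₀ S ∧ AvoidsDifferences C₁ S ∧ Disjoint C₀ C₁ ∧
      C₀ ⊆ Finset.range N ∧ C₁ ⊆ Finset.range N ∧ 0 ∈ C₀ ∧
      C₀.card + C₁.card = B₀.card + B₁.card := by
  wlog hmin : (B₀ ∪ B₁).min' hne ∈ B₀ generalizing B₀ B₁
  · have hmem := (B₀ ∪ B₁).min'_mem hne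
    have hne' : (B₁ ∪ B₀).Nonempty := by rwa [Finset.union_comm]
    have := this h₁ h₀ hd.symm hB₁ hB₀ hne' (by
      simp only [Finset.union_comm B₁ B₀]
      exact (Finset.mem_union.1 hmem).resolve_left hmin)
    rwa [add_comm B₁.card] at this
  set a := (B₀ ∪ B₁).min' hne with ha
  have ha₀ : ∀ x ∈ B₀, a ≤ x := fun x hx => Finset.min'_le _ _ (Finset.mem_union_left _ hx)
  have ha₁ : ∀ x ∈ B₁, a ≤ x := fun x hx => Finset.min'_le _ _ (Finset.mem_union_right _ hx)
  have hrange : ∀ B : Finset ℕ, B ⊆ Finset.range N →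
      (B.image fun x => x - a) ⊆ Finset.range N := by
    intro B hB y hy
    obtain ⟨x, hx, rfl⟩ := Finset.mem_image.1 hy
    exact Finset.mem_range.2 ((Nat.sub_le _ _).trans_lt (Finset.mem_range.1 (hB hx)))
  have hcard : ∀ B : Finset ℕ, (∀ x ∈ B, a ≤ x) → (B.image fun x => x - a).card = B.card := by
    intro B hB
    refine Finset.card_image_of_injOn fun x hx y hy hxy => ?_
    have := hB x hx
    have := hB y hy
    omega
  refine ⟨B₀.image fun x => x - a, B₁.image fun x => x - a, h₀.shift ha₀, h₁.shift ha₁, ?_,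
    hrange _ hB₀, hrange _ hB₁, ?_, by rw [hcard _ ha₀, hcard _ ha₁]⟩
  · rw [Finset.disjoint_left]
    intro y hy hy'
    obtain ⟨x, hx, rfl⟩ := Finset.mem_image.1 hy
    obtain ⟨x', hx', he⟩ := Finset.mem_image.1 hy'
    have := ha₀ x hx
    have := ha₁ x' hx'
    have hxx : x = x' := by omega
    exact Finset.disjoint_left.1 hd hx (hxx ▸ hx')
  · exact Finset.mem_image.2 ⟨a, hmin, Nat.sub_self a⟩

/-- The coordinates `t < n` for which `⌊x θ t + s⌋` is odd. -/
noncomputable def oddFloors (n : ℕ) (θ : ℕ → ℝ) (s : ℝ) (x : ℕ) : Finset ℕ :=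
  (Finset.range n).filter fun t => Odd ⌊x * θ t + s⌋

theorem oddFloors_subset (n : ℕ) (θ : ℕ → ℝ) (s : ℝ) (x : ℕ) :
    oddFloors n θ s x ⊆ Finset.range n := Finset.filter_subset _ _

/-- The fractional parts of `x θ t + s` for `t < n` are at distance at least `ρ` from `0`
and `1`. -/
def FarFromInt (n : ℕ) (θ : ℕ → ℝ) (ρ s : ℝ) (x : ℕ) : Prop :=
  ∀ t < n, ρ ≤ Int.fract (x * θ t + s) ∧ Int.fract (x * θ t + s) ≤ 1 - ρ

/-- Since `y = x - a + b`, passing to `y` moves `x θ t` by `1_w - 1_v` mod 2 up to `ρ / 2`. Only `x`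
need be far from integers for the floor to follow. -/
theorem oddFloors_symmDiff {n : ℕ} {θ : ℕ → ℝ} {ρ s : ℝ} {x y : ℕ} {v w : Finset ℕ} {a b : ℤ}
    (hx : FarFromInt n θ ρ s x) (hv : v ⊆ Finset.range n) (hw : w ⊆ Finset.range n)
    (hvw : Disjoint v w) (hxy : (x : ℤ) - y = a - b)
    (ha : ∀ t < n, ∃ z : ℤ, |a * θ t - (if t ∈ v then 1 else 0) - 2 * z| ≤ ρ / 4)
    (hb : ∀ t < n, ∃ z : ℤ, |b * θ t - (if t ∈ w then 1 else 0) - 2 * z| ≤ ρ / 4) (hρ : 0 < ρ) :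
    symmDiff (oddFloors n θ s x) (oddFloors n θ s y) = v ∪ w := by
  ext t
  by_cases ht : t < n
  · obtain ⟨z, hz⟩ := ha t ht
    obtain ⟨z', hz'⟩ := hb t ht
    have hxy' : (y : ℝ) = x - a + b := by
      have : ((x : ℤ) : ℝ) - ((y : ℤ) : ℝ) = a - b := by exact_mod_cast hxy
      push_cast at this
      linarith
    have hfl := Int.floor_eq_add_of_abs_sub_lt (z' := y * θ t + s)
      (h := (if t ∈ w then 1 else 0) - (if t ∈ v then 1 else 0) + 2 * (z' - z))
      (hx t ht).1 (hx t ht).2 (by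
        have e : (y * θ t + s) - (x * θ t + s)
            - (((if t ∈ w then 1 else 0) - (if t ∈ v then 1 else 0) + 2 * (z' - z) : ℤ) : ℝ)
            = (b * θ t - (if t ∈ w then 1 else 0) - 2 * z')
              - (a * θ t - (if t ∈ v then 1 else 0) - 2 * z) := by
          rw [hxy']
          push_cast
          ring
        rw [e]
        exact (abs_sub _ _).trans_lt (by linarith))
    have hdis : ¬ (t ∈ v ∧ t ∈ w) := fun h => Finset.disjoint_left.1 hvw h.1 h.2
    simp only [oddFloors, Finset.mem_symmDiff, Finset.mem_filter, Finset.mem_range, ht, true_and,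
      Finset.mem_union, hfl, Int.odd_iff]
    by_cases h1 : t ∈ v <;> by_cases h2 : t ∈ w <;> simp only [h1, h2, if_true, if_false] at * <;>
      first
      | exact (hdis ⟨trivial, trivial⟩).elim
      | (simp only [or_true, or_false, iff_true, iff_false]; omega)
  · have h1 : t ∉ v := fun h => ht (Finset.mem_range.1 (hv h))
    have h2 : t ∉ w := fun h => ht (Finset.mem_range.1 (hw h))
    simp [oddFloors, Finset.mem_symmDiff, ht, h1, h2]

theorem Finset.card_symmDiff_le (U V : Finset ℕ) : (symmDiff U V).card ≤ U.card + V.card := by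
  refine (Finset.card_le_card (t := U ∪ V) ?_).trans (Finset.card_union_le U V)
  intro t ht
  rw [Finset.mem_symmDiff] at ht
  rw [Finset.mem_union]
  tauto

theorem card_filter_powerset_symmDiff (R W : Finset ℕ) (hW : W ⊆ R) (p : Finset ℕ → Prop)
    [DecidablePred p] :
    (R.powerset.filter fun β => p (symmDiff W β)).card = (R.powerset.filter p).card := by
  refine Finset.card_nbij' (fun β => symmDiff W β) (fun β => symmDiff W β) ?_ ?_ ?_ ?_
  · intro β hβ
    simp only [Finset.coe_filter, Finset.mem_powerset, Set.mem_ofPred_eq] at hβ ⊢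
    exact ⟨(Finset.symmDiff_subset_union).trans (Finset.union_subset hW hβ.1), hβ.2⟩
  · intro β hβ
    simp only [Finset.coe_filter, Finset.mem_powerset, Set.mem_ofPred_eq] at hβ ⊢
    refine ⟨(Finset.symmDiff_subset_union).trans (Finset.union_subset hW hβ.1), ?_⟩
    rw [symmDiff_symmDiff_cancel_left]
    exact hβ.2
  · intro β _
    exact symmDiff_symmDiff_cancel_left W β
  · intro β _
    exact symmDiff_symmDiff_cancel_left W β

theorem card_filter_farFromInt {n Q : ℕ} (hQ : 0 < Q) (θ : ℕ → ℝ) {ρ : ℝ} (hρ : 2 * ρ * Q ≤ 1)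
    (x : ℕ) [DecidablePred fun i : ℕ => FarFromInt n θ ρ ((i : ℝ) / Q) x] :
    Q ≤ ((Finset.range Q).filter fun i : ℕ => FarFromInt n θ ρ ((i : ℝ) / Q) x).card + n := by
  classical
  have h1 := Finset.card_filter_add_card_filter_not (s := Finset.range Q)
    (fun i : ℕ => FarFromInt n θ ρ ((i : ℝ) / Q) x)
  have h2 : ((Finset.range Q).filter fun i : ℕ => ¬ FarFromInt n θ ρ ((i : ℝ) / Q) x).card ≤ n := by
    have hsub : ((Finset.range Q).filter fun i : ℕ => ¬ FarFromInt n θ ρ ((i : ℝ) / Q) x)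
        ⊆ (Finset.range n).biUnion fun t => (Finset.range Q).filter fun i : ℕ =>
          ¬ (ρ ≤ Int.fract (x * θ t + i / Q) ∧ Int.fract (x * θ t + i / Q) ≤ 1 - ρ) := by
      intro i hi
      simp only [Finset.mem_filter, FarFromInt, not_forall] at hi
      obtain ⟨hi, t, ht, hit⟩ := hi
      simp only [Finset.mem_biUnion, Finset.mem_filter]
      exact ⟨t, Finset.mem_range.2 ht, hi, hit⟩
    refine (Finset.card_le_card hsub).trans (Finset.card_biUnion_le.trans ?_)
    refine (Finset.sum_le_card_nsmul _ _ 1 fun t _ => card_filter_fract_le_one _ hQ hρ).trans ?_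
    simp
  rw [Finset.card_range] at h1
  omega

open Classical in
/-- For a suitable shift and a suitable flip of the coordinates, most `x < N` have all `x θ t`
far from the integers and an unbalanced set of odd coordinates. -/
theorem exists_shift_flip {m c k n Q : ℕ} (hk : k + c = m) (hn : n = 2 * m) (hQ : 0 < Q)
    (θ : ℕ → ℝ) {ρ δ : ℝ} (hρ : 2 * ρ * Q ≤ 1) (hδ : δ ≤ 1) (hnQ : (n : ℝ) ≤ δ * Q)
    (hm : ((2 * c + 1 : ℕ) : ℝ) * m.centralBinom ≤ δ * 4 ^ m) (N : ℕ) :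
    ∃ (s : ℝ) (β : Finset ℕ), β ⊆ Finset.range n ∧ (1 - 2 * δ) * N ≤
      ((Finset.range N).filter fun x => FarFromInt n θ ρ s x ∧
        ((symmDiff (oddFloors n θ s x) β).card < k ∨
          (Finset.range n \ symmDiff (oddFloors n θ s x) β).card < k)).card := by
  set R := Finset.range n with hR
  have hRc : R.card = 2 * m := by rw [hR, Finset.card_range, hn]
  let p : Finset ℕ → Prop := fun U => U.card < k ∨ (R \ U).card < k
  let I := Finset.range Q ×ˢ R.powerset
  let G : ℕ → ℕ × Finset ℕ → Prop := fun x i =>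
    FarFromInt n θ ρ ((i.1 : ℝ) / Q) x ∧ p (symmDiff (oddFloors n θ ((i.1 : ℝ) / Q) x) i.2)
  have hp : (1 - δ) * 4 ^ m ≤ ((R.powerset.filter p).card : ℝ) := by
    have h1 := Finset.card_filter_add_card_filter_not (s := R.powerset) p
    have h2 := card_filter_middle_le hk R hRc
    rw [Finset.card_powerset, hRc, pow_mul] at h1
    have h1' : ((R.powerset.filter p).card : ℝ) + ((R.powerset.filter fun U => ¬ p U).card : ℝ)
        = 4 ^ m := by
      exact_mod_cast h1
    have h2' : ((R.powerset.filter fun U => ¬ p U).card : ℝ)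
        ≤ ((2 * c + 1 : ℕ) : ℝ) * m.centralBinom := by
      exact_mod_cast h2
    linarith
  -- For fixed `x` and shift, a uniform flip makes the odd set uniform among subsets of `R`, so no
  -- equidistribution of `x θ t` is needed. Averaging over shifts and flips then finds one good for
  -- most `x`.
  have hrow : ∀ x, (1 - δ) * Q * ((1 - δ) * 4 ^ m) ≤ ((I.filter fun i => G x i).card : ℝ) := by
    intro x
    have h1 : (I.filter fun i => G x i).card = ∑ i ∈ (Finset.range Q).filter fun i : ℕ =>
        FarFromInt n θ ρ ((i : ℝ) / Q) x, (R.powerset.filter p).card := by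
      rw [Finset.card_filter, Finset.sum_product, Finset.sum_filter]
      refine Finset.sum_congr rfl fun i _ => ?_
      split_ifs with h
      · rw [← card_filter_powerset_symmDiff R (oddFloors n θ ((i : ℝ) / Q) x)
          (oddFloors_subset _ _ _ _) p, Finset.card_filter]
        simp only [G, h, true_and]
      · simp [G, h]
    rw [h1, Finset.sum_const, smul_eq_mul, Nat.cast_mul]
    have h2 := card_filter_farFromInt (n := n) hQ θ hρ x
    have h2' : (Q : ℝ) ≤ (((Finset.range Q).filter fun i : ℕ =>
        FarFromInt n θ ρ ((i : ℝ) / Q) x).card : ℝ) + n := by exact_mod_cast h2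
    have h3 : 0 ≤ (1 - δ) * 4 ^ m := mul_nonneg (by linarith) (by positivity)
    exact mul_le_mul (by linarith) hp h3 (by positivity)
  have hcount : ∑ i ∈ I, ((1 - 2 * δ) * N : ℝ)
      ≤ ∑ i ∈ I, (((Finset.range N).filter fun x => G x i).card : ℝ) := by
    have h1 : ∑ i ∈ I, (((Finset.range N).filter fun x => G x i).card : ℝ)
        = ∑ x ∈ Finset.range N, ((I.filter fun i => G x i).card : ℝ) := by
      exact_mod_cast Finset.sum_card_bipartiteAbove_eq_sum_card_bipartiteBelow
        (s := I) (t := Finset.range N) (fun i x => G x i)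
    rw [h1]
    refine le_trans ?_ (Finset.card_nsmul_le_sum _ _ _ fun x _ => hrow x)
    rw [Finset.sum_const, nsmul_eq_mul, nsmul_eq_mul, Finset.card_range]
    have hI : (I.card : ℝ) = Q * 4 ^ m := by
      rw [Finset.card_product, Finset.card_powerset, hRc, pow_mul, Finset.card_range]
      norm_num
    rw [hI]
    have : (1 - 2 * δ) ≤ (1 - δ) * (1 - δ) := by nlinarith [sq_nonneg δ]
    calc (Q : ℝ) * 4 ^ m * ((1 - 2 * δ) * N) = (1 - 2 * δ) * (N * Q * 4 ^ m) := by ring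
      _ ≤ (1 - δ) * (1 - δ) * (N * Q * 4 ^ m) := by gcongr
      _ = N * ((1 - δ) * Q * ((1 - δ) * 4 ^ m)) := by ring
  have hI : I.Nonempty :=
    ⟨(0, ∅), Finset.mem_product.2 ⟨Finset.mem_range.2 hQ, Finset.empty_mem_powerset _⟩⟩
  obtain ⟨i, hi, hle⟩ := Finset.exists_le_of_sum_le hI hcount
  exact ⟨(i.1 : ℝ) / Q, i.2, Finset.mem_powerset.1 (Finset.mem_product.1 hi).2, hle⟩

-- Two sets with fewer than `k` elements differ in fewer than `2k` places.
open Classical in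
theorem avoidsDifferences_filter {P : ℕ → Prop} {U : ℕ → Finset ℕ} {S : Set ℤ} {k : ℕ}
    (h : ∀ x y : ℕ, P x → (x : ℤ) - y ∈ S → 2 * k ≤ (symmDiff (U x) (U y)).card) (X : Finset ℕ) :
    AvoidsDifferences (X.filter fun x => P x ∧ (U x).card < k) S := by
  intro x hx y hy hxy
  have hx := (Finset.mem_filter.1 hx).2
  have hy := (Finset.mem_filter.1 hy).2
  have h1 := h x y hx.1 hxy
  have h2 := Finset.card_symmDiff_le (U x) (U y)
  have h3 := hx.2
  have h4 := hy.2
  omega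

open Classical in
/-- Splitting a family of unbalanced subsets of `R` into the small and the large ones. -/
theorem exists_avoidsDifferences_pair {P : ℕ → Prop} {U : ℕ → Finset ℕ} {S : Set ℤ}
    {k N : ℕ} {R : Finset ℕ} (hR : 2 * k ≤ R.card) (hU : ∀ x, U x ⊆ R)
    (h : ∀ x y : ℕ, P x → (x : ℤ) - y ∈ S → 2 * k ≤ (symmDiff (U x) (U y)).card)
    (hne : ((Finset.range N).filter fun x => P x ∧
      ((U x).card < k ∨ (R \ U x).card < k)).Nonempty) :
    ∃ B₀ B₁ : Finset ℕ, AvoidsDifferences B₀ S ∧ AvoidsDifferences B₁ S ∧ Disjoint B₀ B₁ ∧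
      B₀ ⊆ Finset.range N ∧ B₁ ⊆ Finset.range N ∧ 0 ∈ B₀ ∧
      B₀.card + B₁.card = ((Finset.range N).filter fun x => P x ∧
        ((U x).card < k ∨ (R \ U x).card < k)).card := by
  have h₀ := avoidsDifferences_filter h (Finset.range N)
  have h₁ := avoidsDifferences_filter (P := P) (U := fun x => R \ U x) (S := S) (k := k)
    (fun x y hx hxy => by
      have h3 : symmDiff (R \ U x) (R \ U y) = symmDiff (U x) (U y) := by
        ext t
        have hxt := @hU x t
        have hyt := @hU y t
        simp only [Finset.mem_symmDiff, Finset.mem_sdiff]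
        tauto
      rw [h3]
      exact h x y hx hxy) (Finset.range N)
  have hd : Disjoint ((Finset.range N).filter fun x => P x ∧ (U x).card < k)
      ((Finset.range N).filter fun x => P x ∧ (R \ U x).card < k) := by
    rw [Finset.disjoint_left]
    intro x hx hx'
    have h1 := (Finset.mem_filter.1 hx).2.2
    have h2 := (Finset.mem_filter.1 hx').2.2
    have := Finset.card_sdiff_add_card_eq_card (hU x)
    omega
  have hunion : ((Finset.range N).filter fun x => P x ∧ (U x).card < k) ∪
      ((Finset.range N).filter fun x => P x ∧ (R \ U x).card < k)
      = (Finset.range N).filter fun x => P x ∧ ((U x).card < k ∨ (R \ U x).card < k) := by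
    rw [← Finset.filter_or]
    simp only [and_or_left]
  rw [← hunion] at hne ⊢
  rw [Finset.card_union_of_disjoint hd]
  exact h₀.exists_zero_mem h₁ hd (Finset.filter_subset _ _) (Finset.filter_subset _ _) hne

/-- Every infinite set of integers has a finite set of differences which is recurrent for
colorings with `c` colors, while long intervals are almost covered by two disjoint sets that
avoid it. -/
theorem Set.Infinite.exists_isChromaticRecurrent_avoidsDifferences {E : Set ℤ} (hE : E.Infinite)
    (c : ℕ) {δ : ℝ} (hδ : 0 < δ) (hδ1 : δ < 1) :
    ∃ S : Set ℤ, S.Finite ∧ S ⊆ E - E ∧ IsChromaticRecurrent c S ∧ ∀ N : ℕ, 0 < N →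
      ∃ B₀ B₁ : Finset ℕ, AvoidsDifferences B₀ S ∧ AvoidsDifferences B₁ S ∧ Disjoint B₀ B₁ ∧
        B₀ ⊆ Finset.range N ∧ B₁ ⊆ Finset.range N ∧ 0 ∈ B₀ ∧
        (1 - δ) * N ≤ (B₀.card : ℝ) + B₁.card := by
  classical
  -- With `n = 2m` and `k = m - c`, Kneser's theorem handles `c` colors, and only the `2c + 1`
  -- layers from `k` to `k + 2c` are lost. The bad shifts and the middle layers each cost `δ / 2`.
  obtain ⟨m, hm, hbin⟩ := exists_mul_centralBinom_le (2 * c + 1) (half_pos hδ)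
  obtain ⟨k, rfl⟩ : ∃ k, m = k + c := ⟨m - c, by omega⟩
  set m := k + c with hmdef
  set n := 2 * m with hn
  obtain ⟨Q, hQ⟩ := exists_nat_gt ((n : ℝ) / (δ / 2))
  have hnQ : (n : ℝ) ≤ δ / 2 * Q := by
    rw [div_lt_iff₀ (half_pos hδ)] at hQ
    linarith
  have hQ0 : 0 < Q := by
    have : (0 : ℝ) < Q := lt_of_le_of_lt (by positivity) hQ
    exact_mod_cast this
  have hQ0' : (0 : ℝ) < Q := by exact_mod_cast hQ0
  let ρ : ℝ := 1 / (2 * Q)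
  have hρ : 0 < ρ := by positivity
  have hρQ : 2 * ρ * Q ≤ 1 := by
    have : 2 * ρ * Q = 1 := by simp only [ρ]; field_simp
    exact this.le
  set V := (Finset.range n).powersetCard k with hV
  obtain ⟨e, heE, l, hl, he⟩ := hE.exists_approx_mod_two (by positivity : 0 < ρ / 4) V
  have hθ : ∀ t : ℕ, ∃ θ : ℝ, ∀ v ∈ V, ∃ z : ℤ,
      |e v * θ - (if t ∈ v then 1 else 0) - 2 * z| ≤ ρ / 4 := by
    intro t
    obtain ⟨a, ha⟩ := he fun v => if t ∈ v then 1 else 0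
    exact ⟨a, ha a ⟨le_rfl, by linarith⟩⟩
  choose θ hθ using hθ
  let S : Set ℤ := {s | ∃ v ∈ V, ∃ w ∈ V, Disjoint v w ∧ s = e v - e w}
  have hsymm : ∀ (s : ℝ) (β : Finset ℕ) (x y : ℕ), FarFromInt n θ ρ s x → (x : ℤ) - y ∈ S →
      2 * k = (symmDiff (symmDiff (oddFloors n θ s x) β)
        (symmDiff (oddFloors n θ s y) β)).card := by
    rintro s β x y hx ⟨v, hv, w, hw, hvw, hxy⟩
    have hv' := Finset.mem_powersetCard.1 hv
    have hw' := Finset.mem_powersetCard.1 hw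
    have := oddFloors_symmDiff hx hv'.1 hw'.1 hvw hxy (fun t _ => hθ t v hv)
      (fun t _ => hθ t w hw) hρ
    rw [symmDiff_symmDiff_symmDiff_comm, symmDiff_self, symmDiff_bot, this,
      Finset.card_union_of_disjoint hvw, hv'.2, hw'.2]
    ring
  refine ⟨S, ?_, ?_, ?_, fun N hN => ?_⟩
  · refine ((V ×ˢ V).image fun q => e q.1 - e q.2).finite_toSet.subset ?_
    rintro s ⟨v, hv, w, hw, -, rfl⟩
    exact Finset.mem_coe.2 (Finset.mem_image.2 ⟨(v, w), Finset.mem_product.2 ⟨hv, hw⟩, rfl⟩)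
  · rintro s ⟨v, hv, w, hw, -, rfl⟩
    exact Set.sub_mem_sub (heE v hv) (heE w hw)
  · intro f
    obtain ⟨v, hv, w, hw, hvw, hc⟩ := exists_disjoint_powersetCard_color_eq (n := n) (k := k)
      (c := c) (by omega) (by omega) (by omega) fun v => f (e v)
    exact ⟨e v, e w, hc, v, hv, w, hw, hvw, rfl⟩
  · obtain ⟨s, β, hβ, hcard⟩ := exists_shift_flip (k := k) hmdef.symm hn hQ0 θ hρQ
      (by linarith : δ / 2 ≤ 1) hnQ hbin N
    have hpos : (0 : ℝ) < (1 - 2 * (δ / 2)) * N :=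
      mul_pos (by linarith) (by exact_mod_cast hN)
    obtain ⟨C₀, C₁, a0, a1, a2, a3, a4, a5, a6⟩ := exists_avoidsDifferences_pair
      (S := S) (P := FarFromInt n θ ρ s) (R := Finset.range n) (k := k) (N := N)
      (U := fun x => symmDiff (oddFloors n θ s x) β) (by rw [Finset.card_range]; omega)
      (fun x => Finset.symmDiff_subset_union.trans
        (Finset.union_subset (oddFloors_subset _ _ _ _) hβ))
      (fun x y hx hxy => (hsymm s β x y hx hxy).le)
      (Finset.card_pos.1 (by exact_mod_cast hpos.trans_le hcard))
    refine ⟨C₀, C₁, a0, a1, a2, a3, a4, a5, ?_⟩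
    rw [← a6, Nat.cast_add] at hcard
    refine le_trans (le_of_eq ?_) hcard
    ring

/-! ### Combining two scales -/

theorem IsChromaticRecurrent.mono {c : ℕ} {S S' : Set ℤ} (h : IsChromaticRecurrent c S)
    (hS : S ⊆ S') : IsChromaticRecurrent c S' := fun f =>
  let ⟨x, y, hxy, hs⟩ := h f
  ⟨x, y, hxy, hS hs⟩

theorem IsChromaticRecurrent.image_mul {c : ℕ} {S : Set ℤ} (h : IsChromaticRecurrent c S)
    (T : ℤ) : IsChromaticRecurrent c ((fun s => T * s) '' S) := by
  intro f
  obtain ⟨x, y, hxy, hs⟩ := h fun x => f (T * x)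
  exact ⟨T * x, T * y, hxy, x - y, hs, mul_sub T x y⟩

/-- The numbers `r + T q` with `r ∈ D` and `q ∈ B`. -/
def blockSum (T : ℕ) (D B : Finset ℕ) : Finset ℕ :=
  (D ×ˢ B).image fun p => p.1 + T * p.2

theorem mem_blockSum {T : ℕ} {D B : Finset ℕ} {x : ℕ} :
    x ∈ blockSum T D B ↔ ∃ r ∈ D, ∃ q ∈ B, r + T * q = x := by
  simp only [blockSum, Finset.mem_image, Finset.mem_product, Prod.exists]
  constructor
  · rintro ⟨r, q, ⟨hr, hq⟩, h⟩
    exact ⟨r, hr, q, hq, h⟩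
  · rintro ⟨r, hr, q, hq, h⟩
    exact ⟨r, q, ⟨hr, hq⟩, h⟩

theorem eq_of_add_mul_eq {T r r' q q' : ℕ} (hr : r < T) (hr' : r' < T)
    (h : r + T * q = r' + T * q') : r = r' ∧ q = q' := by
  have hT : 0 < T := by omega
  have h1 : r = r' := by
    have := congrArg (· % T) h
    simpa [Nat.add_mul_mod_self_left, Nat.mod_eq_of_lt hr, Nat.mod_eq_of_lt hr'] using this
  subst h1
  exact ⟨rfl, Nat.eq_of_mul_eq_mul_left hT (by omega)⟩

theorem card_blockSum {T : ℕ} {D B : Finset ℕ} (hD : ∀ r ∈ D, r < T) :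
    (blockSum T D B).card = D.card * B.card := by
  rw [blockSum, Finset.card_image_of_injOn, Finset.card_product]
  rintro ⟨r, q⟩ h ⟨r', q'⟩ h' he
  simp only [Finset.coe_product, Set.mem_prod, Finset.mem_coe] at h h'
  obtain ⟨rfl, rfl⟩ := eq_of_add_mul_eq (hD r h.1) (hD r' h'.1) he
  rfl

theorem disjoint_blockSum {T : ℕ} {D D' B B' : Finset ℕ} (hD : ∀ r ∈ D, r < T)
    (hD' : ∀ r ∈ D', r < T) (h : Disjoint D D' ∨ Disjoint B B') :
    Disjoint (blockSum T D B) (blockSum T D' B') := by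
  rw [Finset.disjoint_left]
  intro x hx hx'
  obtain ⟨r, hr, q, hq, rfl⟩ := mem_blockSum.1 hx
  obtain ⟨r', hr', q', hq', he⟩ := mem_blockSum.1 hx'
  obtain ⟨rfl, rfl⟩ := eq_of_add_mul_eq (hD' r' hr') (hD r hr) he
  rcases h with h | h
  · exact Finset.disjoint_left.1 h hr hr'
  · exact Finset.disjoint_left.1 h hq hq'

theorem blockSum_subset_range {M L N : ℕ} {D B : Finset ℕ} (hD : D ⊆ Finset.range M)
    (hB : B ⊆ Finset.range N) : blockSum (M + L) D B ⊆ Finset.range ((M + L) * N) := by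
  intro x hx
  obtain ⟨r, hr, q, hq, rfl⟩ := mem_blockSum.1 hx
  have h1 := Finset.mem_range.1 (hD hr)
  have h2 := Finset.mem_range.1 (hB hq)
  rw [Finset.mem_range]
  calc r + (M + L) * q < (M + L) + (M + L) * q := by omega
    _ = (M + L) * (q + 1) := by ring
    _ ≤ (M + L) * N := Nat.mul_le_mul_left _ h2

theorem subset_blockSum {T : ℕ} {D B : Finset ℕ} (hB : 0 ∈ B) : D ⊆ blockSum T D B := by
  intro r hr
  exact mem_blockSum.2 ⟨r, hr, 0, hB, by simp⟩

/-- Combining two levels: the differences of the combined set avoid both the short differences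
`S` and the multiples of the long period. -/
theorem AvoidsDifferences.blockSum_union {D₀ D₁ B₀ B₁ : Finset ℕ} {S S' : Set ℤ} {M L : ℕ}
    (hD₀ : AvoidsDifferences D₀ S) (hD₁ : AvoidsDifferences D₁ S) (hD : Disjoint D₀ D₁)
    (hM₀ : D₀ ⊆ Finset.range M) (hM₁ : D₁ ⊆ Finset.range M) (hL : ∀ s ∈ S, |s| ≤ L)
    (hB₀ : AvoidsDifferences B₀ S') (hB₁ : AvoidsDifferences B₁ S') (hB : Disjoint B₀ B₁) :
    AvoidsDifferences (blockSum (M + L) D₀ B₀ ∪ blockSum (M + L) D₁ B₁)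
      (S ∪ (fun s => ((M + L : ℕ) : ℤ) * s) '' S') := by
  have hmem : ∀ x ∈ blockSum (M + L) D₀ B₀ ∪ blockSum (M + L) D₁ B₁, ∃ r q : ℕ,
      r < M ∧ r + (M + L) * q = x ∧ ((r ∈ D₀ ∧ q ∈ B₀) ∨ (r ∈ D₁ ∧ q ∈ B₁)) := by
    intro x hx
    rcases Finset.mem_union.1 hx with hx | hx
    · obtain ⟨r, hr, q, hq, h⟩ := mem_blockSum.1 hx
      exact ⟨r, q, Finset.mem_range.1 (hM₀ hr), h, Or.inl ⟨hr, hq⟩⟩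
    · obtain ⟨r, hr, q, hq, h⟩ := mem_blockSum.1 hx
      exact ⟨r, q, Finset.mem_range.1 (hM₁ hr), h, Or.inr ⟨hr, hq⟩⟩
  have hDD : ∀ r, r ∈ D₀ → r ∈ D₁ → False := fun r h h' => Finset.disjoint_left.1 hD h h'
  have hBB : ∀ r, r ∈ B₀ → r ∈ B₁ → False := fun r h h' => Finset.disjoint_left.1 hB h h'
  intro x hx y hy hxy
  obtain ⟨r, q, hr, rfl, h⟩ := hmem x hx
  obtain ⟨r', q', hr', rfl, h'⟩ := hmem y hy
  rcases hxy with hxy | ⟨s, hs, hxy⟩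
  -- Points of different blocks are more than `L` apart; within a block, `q` determines which of
  -- `D₀`, `D₁` is used.
  · have habs := abs_le.1 (hL _ hxy)
    push_cast at habs
    rcases lt_trichotomy q q' with hq | rfl | hq
    · obtain ⟨d, rfl⟩ := Nat.exists_eq_add_of_lt hq
      have : (0 : ℤ) ≤ ((M : ℤ) + L) * d := by positivity
      push_cast at habs
      nlinarith [habs.1]
    · have e : ((r + (M + L) * q : ℕ) : ℤ) - ((r' + (M + L) * q : ℕ) : ℤ) = (r : ℤ) - r' := by
        push_cast
        ring
      rw [e] at hxy
      rcases h with ⟨a, b⟩ | ⟨a, b⟩ <;> rcases h' with ⟨a', b'⟩ | ⟨a', b'⟩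
      · exact hD₀ r a r' a' hxy
      · exact hBB _ b b'
      · exact hBB _ b' b
      · exact hD₁ r a r' a' hxy
    · obtain ⟨d, rfl⟩ := Nat.exists_eq_add_of_lt hq
      have : (0 : ℤ) ≤ ((M : ℤ) + L) * d := by positivity
      push_cast at habs
      nlinarith [habs.2]
  · have e : (r : ℤ) - r' = ((M + L : ℕ) : ℤ) * (s - (q - q')) := by
      have hxy' : ((M + L : ℕ) : ℤ) * s
          = ((r + (M + L) * q : ℕ) : ℤ) - ((r' + (M + L) * q' : ℕ) : ℤ) := hxy
      push_cast at hxy' ⊢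
      linarith
    -- A multiple of the period between residues below `M` is 0; the common residue then determines
    -- which of `B₀`, `B₁` is used.
    have hz : (r : ℤ) - r' = 0 := by
      refine Int.eq_zero_of_abs_lt_dvd ⟨_, e⟩ ?_
      rw [abs_lt]
      push_cast
      constructor <;> omega
    have hrr : r = r' := by omega
    subst hrr
    have hs' : s = (q : ℤ) - q' := by
      rw [hz, eq_comm, mul_eq_zero] at e
      rcases e with e | e
      · push_cast at e
        omega
      · omega
    rw [hs'] at hs
    rcases h with ⟨a, b⟩ | ⟨a, b⟩ <;> rcases h' with ⟨a', b'⟩ | ⟨a', b'⟩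
    · exact hB₀ q b q' b' hs
    · exact hDD _ a a'
    · exact hDD _ a' a
    · exact hB₁ q b q' b' hs

/-! ### The inductive construction -/

/-- Pigeonhole on residues. The differences of the resulting set become differences of `E` when
multiplied by `T`. -/
theorem Set.Infinite.exists_residue {E : Set ℤ} (hE : E.Infinite) {T : ℕ} (hT : 0 < T) :
    ∃ r : ℤ, {e : ℤ | (T : ℤ) * e + r ∈ E}.Infinite := by
  by_contra! hcon
  have hfin : (⋃ r ∈ Finset.range T,
      (fun e : ℤ => (T : ℤ) * e + r) '' {e : ℤ | (T : ℤ) * e + r ∈ E}).Finite :=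
    (Finset.range T).finite_toSet.biUnion fun r _ => (hcon r).image _
  refine hE (hfin.subset fun x hx => ?_)
  have hT' : (0 : ℤ) < T := by exact_mod_cast hT
  have h0 := Int.emod_nonneg x hT'.ne'
  have h1 := Int.emod_lt_of_pos x hT'
  have hcast : (((x % T).toNat : ℕ) : ℤ) = x % T := Int.toNat_of_nonneg h0
  have hdiv : (T : ℤ) * (x / T) + x % T = x := Int.mul_ediv_add_emod x T
  refine Set.mem_biUnion (x := (x % T).toNat) ?_ ⟨x / T, ?_, ?_⟩
  · exact Finset.mem_range.2 (by omega)
  · change (T : ℤ) * (x / T) + (((x % T).toNat : ℕ) : ℤ) ∈ E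
    rwa [hcast, hdiv]
  · change (T : ℤ) * (x / T) + (((x % T).toNat : ℕ) : ℤ) = x
    rw [hcast, hdiv]

/-- A finite stage of the construction: a bounded set `S` of differences of `E`, and two disjoint
subsets of `{0, …, M - 1}` that avoid `S` and fill more than half of `{0, …, M + L - 1}`. -/
structure AvoidanceStage (E : Set ℤ) where
  S : Set ℤ
  L : ℕ
  M : ℕ
  D₀ : Finset ℕ
  D₁ : Finset ℕ
  subset : S ⊆ E - E
  bound : ∀ s ∈ S, |s| ≤ L
  avoids₀ : AvoidsDifferences D₀ S
  avoids₁ : AvoidsDifferences D₁ S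
  disjoint : Disjoint D₀ D₁
  range₀ : D₀ ⊆ Finset.range M
  range₁ : D₁ ⊆ Finset.range M
  dense : M + L < 2 * (D₀.card + D₁.card)

/-- The trivial stage. -/
def AvoidanceStage.initial (E : Set ℤ) : AvoidanceStage E where
  S := ∅
  L := 0
  M := 1
  D₀ := {0}
  D₁ := ∅
  subset := Set.empty_subset _
  bound := by simp
  avoids₀ := fun _ _ _ _ => Set.notMem_empty _
  avoids₁ := fun _ _ _ _ => Set.notMem_empty _
  disjoint := by simp
  range₀ := by simp
  range₁ := by simp
  dense := by simp

theorem AvoidanceStage.exists_next {E : Set ℤ} (hE : E.Infinite) (c : ℕ) (s : AvoidanceStage E) :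
    ∃ s' : AvoidanceStage E, s.S ⊆ s'.S ∧ IsChromaticRecurrent c s'.S ∧ s.D₀ ⊆ s'.D₀ ∧
      s.D₁ ⊆ s'.D₁ ∧ s.M < s'.M := by
  obtain ⟨S, L, M, D₀, D₁, hSE, hL, hD₀, hD₁, hD, hM₀, hM₁, hdens⟩ := s
  dsimp only
  have hMpos : 0 < M := by
    by_contra! h
    obtain rfl : M = 0 := by omega
    simp only [Finset.range_zero, Finset.subset_empty] at hM₀ hM₁
    simp [hM₀, hM₁] at hdens
  set a := D₀.card + D₁.card with ha
  have ha1 : 1 ≤ a := by omega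
  have ha1' : (1 : ℝ) ≤ a := by exact_mod_cast ha1
  obtain ⟨r, hr⟩ := hE.exists_residue (T := M + L) (by omega)
  obtain ⟨S', hfin, hS', hrec, hB⟩ :=
    hr.exists_isChromaticRecurrent_avoidsDifferences c (δ := 1 / (4 * a)) (by positivity) (by
      rw [div_lt_one (by positivity)]
      linarith)
  set S₁ : Set ℤ := S ∪ (fun s => ((M + L : ℕ) : ℤ) * s) '' S' with hS₁
  obtain ⟨L', hL'⟩ : ∃ L' : ℕ, ∀ s ∈ S₁, |s| ≤ L' := by
    obtain ⟨K, hK⟩ := (hfin.image fun s => |((M + L : ℕ) : ℤ) * s|).bddAbove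
    refine ⟨max L K.toNat, ?_⟩
    rintro s (hs | ⟨s, hs, rfl⟩)
    · exact (hL s hs).trans (by exact_mod_cast le_max_left _ _)
    · have : |((M + L : ℕ) : ℤ) * s| ≤ K := hK ⟨s, hs, rfl⟩
      refine this.trans ((Int.self_le_toNat K).trans ?_)
      exact_mod_cast le_max_right _ _
  -- `L'` is fixed before `N`. Here `M + L ≤ 2a - 1` saves `N`, the loss `δ = 1 / (4a)` costs at
  -- most `N / 2`, and the remaining `N / 2 = L' + 1` pays for the new gap. The condition `0 ∈ B₀`
  -- makes the stages nested.
  obtain ⟨B₀, B₁, hB₀, hB₁, hBd, hN₀, hN₁, h0, hcard⟩ := hB (2 * L' + 2) (by omega)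
  set N := 2 * L' + 2 with hN
  set b := B₀.card + B₁.card with hb
  have hT₀ : ∀ x ∈ D₀, x < M + L := fun x hx => by
    have := Finset.mem_range.1 (hM₀ hx)
    omega
  have hT₁ : ∀ x ∈ D₁, x < M + L := fun x hx => by
    have := Finset.mem_range.1 (hM₁ hx)
    omega
  have hab : 4 * a * N ≤ 4 * a * b + N := by
    have h1 : (1 - 1 / (4 * (a : ℝ))) * N ≤ b := by
      rw [hb]
      push_cast
      exact hcard
    have h2 : (4 * (a : ℝ)) * ((1 - 1 / (4 * (a : ℝ))) * N) = 4 * a * N - N := by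
      field_simp
    have h3 := mul_le_mul_of_nonneg_left h1 (by positivity : (0 : ℝ) ≤ 4 * a)
    rw [h2] at h3
    have h4 : (4 * a * N : ℝ) ≤ 4 * a * b + N := by linarith
    exact_mod_cast h4
  refine ⟨⟨S₁, L', (M + L) * N, blockSum (M + L) D₀ B₀ ∪ blockSum (M + L) D₁ B₁,
    blockSum (M + L) D₀ B₁ ∪ blockSum (M + L) D₁ B₀, ?_, hL', ?_, ?_, ?_, ?_, ?_, ?_⟩,
    ?_, ?_, ?_, ?_, ?_⟩
  · refine Set.union_subset hSE ?_
    rintro _ ⟨s, hs, rfl⟩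
    obtain ⟨x, hx, y, hy, rfl⟩ := hS' hs
    exact ⟨_, hx, _, hy, by ring⟩
  · exact hD₀.blockSum_union hD₁ hD hM₀ hM₁ hL hB₀ hB₁ hBd
  · exact hD₀.blockSum_union hD₁ hD hM₀ hM₁ hL hB₁ hB₀ hBd.symm
  · rw [Finset.disjoint_union_left, Finset.disjoint_union_right, Finset.disjoint_union_right]
    exact ⟨⟨disjoint_blockSum hT₀ hT₀ (Or.inr hBd), disjoint_blockSum hT₀ hT₁ (Or.inl hD)⟩,
      disjoint_blockSum hT₁ hT₀ (Or.inl hD.symm), disjoint_blockSum hT₁ hT₁ (Or.inr hBd.symm)⟩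
  · exact Finset.union_subset (blockSum_subset_range hM₀ hN₀) (blockSum_subset_range hM₁ hN₁)
  · exact Finset.union_subset (blockSum_subset_range hM₀ hN₁) (blockSum_subset_range hM₁ hN₀)
  · rw [Finset.card_union_of_disjoint (disjoint_blockSum hT₀ hT₁ (Or.inl hD)),
      Finset.card_union_of_disjoint (disjoint_blockSum hT₀ hT₁ (Or.inl hD)),
      card_blockSum hT₀, card_blockSum hT₀, card_blockSum hT₁, card_blockSum hT₁]
    have e : D₀.card * B₀.card + D₁.card * B₁.card + (D₀.card * B₁.card + D₁.card * B₀.card)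
        = a * b := by
      rw [ha, hb]
      ring
    rw [e]
    have h5 : (M + L + 1) * N ≤ 2 * a * N := Nat.mul_le_mul_right _ (by omega)
    nlinarith
  · exact Set.subset_union_left
  · exact (hrec.image_mul _).mono Set.subset_union_right
  · exact (subset_blockSum h0).trans Finset.subset_union_left
  · exact (subset_blockSum h0).trans Finset.subset_union_right
  · dsimp only
    nlinarith

/-! ### Bohr recurrence, upper density and the conclusion -/

/-- A set that is recurrent for all finite colorings is a set of Bohr recurrence. -/
theorem isBohrRecurrent_of_isChromaticRecurrent {S : Set ℤ}
    (h : ∀ c, IsChromaticRecurrent c S) : IsBohrRecurrent S := by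
  intro d α ε hε
  -- The color of `n` is a point of a finite `ε / 2`-net near `n • α`; equal colors give `‖(x - y) •
  -- α‖ < ε`.
  obtain ⟨t, -, htfin, ht⟩ := Metric.totallyBounded_iff.1
    (isCompact_univ (X := Fin d → UnitAddCircle)).totallyBounded (ε / 2) (half_pos hε) |>.imp
    fun t ht => (⟨trivial, ht.1, ht.2⟩ : True ∧ t.Finite ∧ _)
  have hcov : ∀ x : Fin d → UnitAddCircle, ∃ y : t, dist x y < ε / 2 := by
    intro x
    obtain ⟨y, hy, hxy⟩ := Set.mem_iUnion₂.1 (ht (Set.mem_univ x))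
    exact ⟨⟨y, hy⟩, hxy⟩
  choose g hg using hcov
  have := htfin.to_subtype
  obtain ⟨c, ⟨φ⟩⟩ := Finite.exists_equiv_fin t
  obtain ⟨x, y, hxy, hs⟩ := h c fun n => φ (g (n • α))
  refine ⟨x - y, hs, ?_⟩
  have he : g (x • α) = g (y • α) := φ.injective hxy
  rw [sub_smul, ← dist_eq_norm]
  have h1 := hg (x • α)
  have h2 := hg (y • α)
  rw [← he] at h2
  linarith [dist_triangle_right (x • α) (y • α) (g (x • α) : Fin d → UnitAddCircle)]

theorem le_upperDensity {A : Set ℤ} {δ : ℝ}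
    (h : ∃ᶠ n : ℕ in atTop, δ * n ≤ ((A ∩ Set.Icc 1 (n : ℤ)).ncard : ℝ)) :
    δ ≤ upperDensity A := by
  refine le_limsup_of_frequently_le ?_ ?_
  · refine (h.and_eventually (eventually_gt_atTop 0)).mono fun n hn => ?_
    have : (0 : ℝ) < n := by exact_mod_cast hn.2
    rw [le_div_iff₀ this]
    exact hn.1
  · refine isBoundedUnder_of ⟨1, fun n => ?_⟩
    refine div_le_one_of_le₀ ?_ (Nat.cast_nonneg n)
    have := Set.ncard_le_ncard (Set.inter_subset_right : A ∩ Set.Icc 1 (n : ℤ) ⊆ _)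
      (Set.finite_Icc _ _)
    rw [← Finset.coe_Icc, Set.ncard_coe_finset, Int.card_Icc] at this
    have h2 : ((n : ℤ) + 1 - 1).toNat = n := by omega
    rw [h2] at this
    exact_mod_cast this

theorem not_isDensityRecurrent_of_avoidsDifferences {S : Set ℤ} (D : ℕ → Finset ℕ)
    (hD : Monotone D) (M : ℕ → ℕ) (hM : StrictMono M) (hDM : ∀ k, D k ⊆ Finset.range (M k))
    (hdens : ∃ᶠ k in atTop, M k ≤ 4 * (D k).card)
    (hS : ∀ s ∈ S, ∀ᶠ k in atTop, ∀ x ∈ D k, ∀ y ∈ D k, (x : ℤ) - y ≠ s) :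
    ¬ IsDensityRecurrent S := by
  intro hrec
  -- The translation by 1 moves `{0, …, M k - 1}` onto the counted interval `{1, …, M k}`.
  let A : Set ℤ := ⋃ k, ((D k).image fun x : ℕ => (x : ℤ) + 1 : Finset ℤ)
  have hA : (1 / 4 : ℝ) ≤ upperDensity A := by
    refine le_upperDensity ?_
    refine hM.tendsto_atTop.frequently (p := fun n : ℕ =>
      (1 / 4 : ℝ) * n ≤ ((A ∩ Set.Icc 1 (n : ℤ)).ncard : ℝ)) (hdens.mono fun k hk => ?_)
    have hsub : (((D k).image fun x : ℕ => (x : ℤ) + 1 : Finset ℤ) : Set ℤ)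
        ⊆ A ∩ Set.Icc 1 (M k : ℤ) := by
      intro z hz
      refine ⟨Set.mem_iUnion.2 ⟨k, hz⟩, ?_⟩
      obtain ⟨x, hx, rfl⟩ := Finset.mem_image.1 (Finset.mem_coe.1 hz)
      have := Finset.mem_range.1 (hDM k hx)
      exact ⟨by omega, by omega⟩
    have hc := Set.ncard_le_ncard hsub ((Set.finite_Icc _ _).inter_of_right _)
    rw [Set.ncard_coe_finset, Finset.card_image_of_injective _ (fun x y h => by
      simpa using h)] at hc
    have h1 : (M k : ℝ) ≤ 4 * (D k).card := by exact_mod_cast hk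
    have h2 : ((D k).card : ℝ) ≤ ((A ∩ Set.Icc 1 (M k : ℤ)).ncard : ℝ) := by exact_mod_cast hc
    linarith
  obtain ⟨s, ⟨x, hx, y, hy, hxy⟩, hs⟩ := hrec A (by linarith)
  obtain ⟨i, hi⟩ := Set.mem_iUnion.1 hx
  obtain ⟨j, hj⟩ := Set.mem_iUnion.1 hy
  obtain ⟨x', hx', rfl⟩ := Finset.mem_image.1 (Finset.mem_coe.1 hi)
  obtain ⟨y', hy', rfl⟩ := Finset.mem_image.1 (Finset.mem_coe.1 hj)
  obtain ⟨k, hk, hki, hkj⟩ :=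
    ((hS s hs).and ((eventually_ge_atTop i).and (eventually_ge_atTop j))).exists
  refine hk x' (hD hki hx') y' (hD hkj hy') ?_
  rw [← hxy]
  ring

theorem mainTheorem4 (E : Set ℤ) (hE : E.Infinite) :
    ∃ S : Set ℤ, S ⊆ E - E ∧ IsBohrRecurrent S ∧ ¬ IsDensityRecurrent S := by
  choose next hS hrec hD₀ hD₁ hM using AvoidanceStage.exists_next hE
  let st : ℕ → AvoidanceStage E := fun k => Nat.rec (AvoidanceStage.initial E) next k
  have hst : ∀ k, st (k + 1) = next k (st k) := fun _ => rfl
  have mS : Monotone fun k => (st k).S := monotone_nat_of_le_succ fun k => hS k (st k)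
  have m₀ : Monotone fun k => (st k).D₀ := monotone_nat_of_le_succ fun k => hD₀ k (st k)
  have m₁ : Monotone fun k => (st k).D₁ := monotone_nat_of_le_succ fun k => hD₁ k (st k)
  have mM : StrictMono fun k => (st k).M := strictMono_nat_of_lt_succ fun k => hM k (st k)
  have hmem : ∀ s ∈ ⋃ k, (st k).S, ∀ᶠ k in atTop, s ∈ (st k).S := by
    intro s hs
    obtain ⟨i, hi⟩ := Set.mem_iUnion.1 hs
    exact (eventually_ge_atTop i).mono fun k hk => mS hk hi
  refine ⟨⋃ k, (st k).S, Set.iUnion_subset fun k => (st k).subset, ?_, ?_⟩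
  · refine isBohrRecurrent_of_isChromaticRecurrent fun c => ?_
    exact (hrec c (st c)).mono (Set.subset_iUnion (fun k => (st k).S) (c + 1))
  -- Which of the two sets is the larger may vary with `k`, but one of them has at least `M / 4`
  -- elements infinitely often.
  · have hfreq : ∃ᶠ k in atTop,
        (st k).M ≤ 4 * (st k).D₀.card ∨ (st k).M ≤ 4 * (st k).D₁.card := by
      refine Frequently.of_forall fun k => ?_
      have := (st k).dense
      omega
    rcases frequently_or_distrib.1 hfreq with h | h
    · exact not_isDensityRecurrent_of_avoidsDifferences _ m₀ _ mM (fun k => (st k).range₀) h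
        fun s hs => (hmem s hs).mono fun k hk x hx y hy he =>
          (st k).avoids₀ x hx y hy (he ▸ hk)
    · exact not_isDensityRecurrent_of_avoidsDifferences _ m₁ _ mM (fun k => (st k).range₁) h
        fun s hs => (hmem s hs).mono fun k hk x hx y hy he =>
          (st k).avoids₁ x hx y hy (he ▸ hk)
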